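/- Let $X$ be a complex Banach space with open unit ball $\mathbb{B}=\{z\in X:\|z\|<1\}$, and for $z\in X\setminus\{0\}$ let $T_z$ be the set of continuous linear functionals $l_z:X\to\mathbb{C}$ with $l_z(z)=\|z\|$ and $\|l_z\|=1$. Let $\mathcal{S}^*(\mathbb{B})$ be the class of normalized starlike mappings, i.e. of the biholomorphic maps $G:\mathbb{B}\to G(\mathbb{B})\subset X$ onto a domain, with $G(0)=0$, $DG(0)=I$, such that $G(\mathbb{B})$ is starlike with respect to the origin. Let $g:\mathbb{B}\to\mathbb{C}$ be holomorphic with $g(0)=1$ and suppose that $G(z)=z\,g(z)$ belongs to $\mathcal{S}^*(\mathbb{B})$. Then for all $z\in\mathbb{B}\setminus\{0\}$ and $l_z\in T_z$, $$\left|2b_2^2b_3-b_3^2-2b_2^2+1\right|\le 24,\qquad\text{where}\quad b_2=\frac{l_z(D^2G(0)(z^2))}{2!\,\|z\|^2},\quad b_3=\frac{l_z(D^3G(0)(z^3))}{3!\,\|z\|^3}.$$ The estimate is sharp: for every $z\in\mathbb{B}\setminus\{0\}$ and every $l_z\in T_z$ there is a holomorphic $g:\mathbb{B}\to\mathbb{C}$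 with $g(0)=1$ and $G(z)=z\,g(z)\in\mathcal{S}^*(\mathbb{B})$ for which equality holds at this $z$ and $l_z$. -/

import Mathlib

noncomputable section

/-- Biholomorphic on `Ω`: `G` is holomorphic on `Ω` (locally the sum of a convergent power series),
`G(Ω)` is a domain, and `G` has a holomorphic inverse `G(Ω) → Ω`. -/
def IsBiholomorphicOn {X : Type*} [NormedAddCommGroup X] [NormedSpace ℂ X]
    (G : X → X) (Ω : Set X) : Prop :=
  AnalyticOnNhd ℂ G Ω ∧ IsOpen (G '' Ω) ∧ IsConnected (G '' Ω) ∧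
    ∃ H : X → X, AnalyticOnNhd ℂ H (G '' Ω) ∧ ∀ z ∈ Ω, H (G z) = z

/-- The class `S(𝔹)`: normalized biholomorphic mappings of the open unit ball into `X`. -/
structure ClassS {X : Type*} [NormedAddCommGroup X] [NormedSpace ℂ X] (G : X → X) : Prop where
  biholomorphic : IsBiholomorphicOn G (Metric.ball 0 1)
  map_zero : G 0 = 0
  fderiv_zero : fderiv ℂ G 0 = ContinuousLinearMap.id ℂ X

/-- The class `S*(𝔹)`: mappings in `S(𝔹)` whose image of the open unit ball is starlike with
respect to the origin. -/
structure ClassSStar {X : Type*} [NormedAddCommGroup X] [NormedSpace ℂ X] (G : X → X) : Prop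
    extends ClassS G where
  starlike : StarConvex ℝ (0 : X) (G '' Metric.ball 0 1)

/-- The set `T_z` of norming functionals of `z`. -/
def normingFunctionals {X : Type*} [NormedAddCommGroup X] [NormedSpace ℂ X] (z : X) :
    Set (X →L[ℂ] ℂ) :=
  {l | l z = (‖z‖ : ℂ) ∧ ‖l‖ = 1}

/-- The normalized coefficient `b_k = l_z (D^k G(0) (z^k)) / (k! ‖z‖^k)`. -/
def normalizedCoeff {X : Type*} [NormedAddCommGroup X] [NormedSpace ℂ X]
    (G : X → X) (z : X) (l : X →L[ℂ] ℂ) (k : ℕ) : ℂ :=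
  l (iteratedFDeriv ℂ k G 0 (fun _ => z)) / ((k.factorial : ℂ) * (‖z‖ : ℂ) ^ k)

end

/-!
For `G(w) = g(w) w` the coefficients `b₂`, `b₃` at `z` only see the complex line through `z`: with
`u = z / ‖z‖` and `h(ζ) = g(ζ u)`, they are the Taylor coefficients of `f(ζ) = ζ h(ζ)`
(`normalizedCoeff_smul_id`). Since `G` maps the disk `𝔹 ∩ ℂ u` onto `G(𝔹) ∩ ℂ u`
(`exists_slice_preimage`), `f` is a univalent function on the unit disk with starlike image.

Starlikeness gives the self-maps `ξ ↦ f⁻¹(t f(ξ))` of the disk, and the Schwarz lemma for them,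
differentiated at `t = 1`, gives `Re (ζ f' / f) ≥ 0` (`norm_mul_deriv_le_of_starlike`). Equivalently
`ψ = h' / (2 h + ζ h')` is bounded by one, and the Schwarz–Pick inequality for `ψ` at the origin
reads `|4 b₃ - 3 b₂²| ≤ 4 - |b₂|²` (`norm_coeff_le_of_norm_mul_deriv_le`). It follows that `|b₂| ≤ 2`,
`|b₃| ≤ 3` and `|b₃ - 2 b₂²| ≤ 5`, whence the determinant
`1 - 2 b₂² + b₃ (2 b₂² - b₃)` is at most `1 + 8 + 15 = 24` in modulus (`norm_toeplitz_le`).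

Equality holds for `G(w) = w / (1 - i l(w))²`, where `b₂ = 2i` and `b₃ = -3`. Its inverse is explicit:
`((1 + iζ) / (1 - iζ))² = 1 + 4iζ / (1 - iζ)²`, so if `s` is the principal square root of
`1 + 4 i l(y)`, then `G⁻¹(y) = 4 y / (s + 1)²`. The image of the ball is the set of `y` with
`1 + 4 i l(y)` off the slit and `‖G⁻¹(y)‖ < 1`; it is starlike because `‖G⁻¹(t y)‖ ≤ ‖G⁻¹(y)‖` for
`0 ≤ t ≤ 1` (`mul_norm_add_one_sq_le`).
-/

open Metric Set Filter Topology ComplexConjugate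

/-! ### Starlike functions on the unit disk -/

/-- The infinitesimal Schwarz–Pick inequality at the origin, obtained by applying the Schwarz lemma
to the composition of `φ` with the disk automorphism moving `φ 0` to `0`. -/
theorem norm_deriv_zero_le_one_sub_sq {φ : ℂ → ℂ} (hd : DifferentiableOn ℂ φ (ball 0 1))
    (hφ : ∀ ζ ∈ ball (0 : ℂ) 1, ‖φ ζ‖ ≤ 1) : ‖deriv φ 0‖ ≤ 1 - ‖φ 0‖ ^ 2 := by
  have h0 : (0 : ℂ) ∈ ball (0 : ℂ) 1 := mem_ball_self one_pos
  rcases (hφ 0 h0).lt_or_eq with ha | ha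
  · have hden : ∀ ζ ∈ ball (0 : ℂ) 1, 1 - conj (φ 0) * φ ζ ≠ 0 := by
      intro ζ hζ h
      have h1 : ‖conj (φ 0) * φ ζ‖ = 1 := by rw [← sub_eq_zero.mp h, norm_one]
      rw [norm_mul, RCLike.norm_conj] at h1
      nlinarith [hφ ζ hζ, norm_nonneg (φ 0), norm_nonneg (φ ζ)]
    set m : ℂ → ℂ := fun ζ => (φ ζ - φ 0) / (1 - conj (φ 0) * φ ζ) with hm
    have hm0 : m 0 = 0 := by simp [hm]
    have hmd : DifferentiableOn ℂ m (ball 0 1) :=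
      (hd.sub_const _).div ((hd.const_mul _).const_sub _) hden
    have hmaps : MapsTo m (ball 0 1) (closedBall (m 0) 1) := by
      intro ζ hζ
      rw [hm0, mem_closedBall_zero_iff, norm_div]
      refine div_le_one_of_le₀ ?_ (norm_nonneg _)
      refine le_of_sq_le_sq ?_ (norm_nonneg _)
      -- `|1 - āw|² - |w - a|² = (1 - |a|²)(1 - |w|²)`
      have e : ‖1 - conj (φ 0) * φ ζ‖ ^ 2 - ‖φ ζ - φ 0‖ ^ 2
          = (1 - ‖φ 0‖ ^ 2) * (1 - ‖φ ζ‖ ^ 2) := by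
        simp only [← Complex.normSq_eq_norm_sq, Complex.normSq_apply, Complex.sub_re,
          Complex.sub_im, Complex.mul_re, Complex.mul_im, Complex.conj_re, Complex.conj_im,
          Complex.one_re, Complex.one_im]
        ring
      have : 0 ≤ (1 - ‖φ 0‖ ^ 2) * (1 - ‖φ ζ‖ ^ 2) :=
        mul_nonneg (by nlinarith [norm_nonneg (φ 0)])
          (by nlinarith [norm_nonneg (φ ζ), hφ ζ hζ])
      linarith
    have hle := Complex.norm_deriv_le_one_of_mapsTo_ball hmd hmaps one_pos
    have hφ' : HasDerivAt φ (deriv φ 0) 0 :=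
      (hd.differentiableAt (ball_mem_nhds _ one_pos)).hasDerivAt
    have hm' := (hφ'.sub_const (φ 0)).div ((hφ'.const_mul (conj (φ 0))).const_sub 1) (hden 0 h0)
    have hpos : 0 < 1 - ‖φ 0‖ ^ 2 := by nlinarith [norm_nonneg (φ 0)]
    have hc : 1 - conj (φ 0) * φ 0 = ((1 - ‖φ 0‖ ^ 2 : ℝ) : ℂ) := by
      rw [Complex.conj_mul']; push_cast; ring
    have hval : deriv m 0 = deriv φ 0 / ((1 - ‖φ 0‖ ^ 2 : ℝ) : ℂ) := by
      have := hm'.deriv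
      rw [hc] at this
      have hne : ((1 - ‖φ 0‖ ^ 2 : ℝ) : ℂ) ≠ 0 := by exact_mod_cast hpos.ne'
      refine this.trans ?_
      field_simp
      ring
    rw [hval, norm_div, Complex.norm_real, Real.norm_of_nonneg hpos.le, div_le_one hpos] at hle
    exact hle
  -- If `|φ 0| = 1` then `φ` is constant by the maximum principle.
  · have hmax : IsMaxOn (norm ∘ φ) (ball 0 1) 0 := fun ζ hζ => by simpa [ha] using hφ ζ hζ
    have hc := Complex.eqOn_of_isPreconnected_of_isMaxOn_norm
      (convex_ball (0 : ℂ) 1).isPreconnected isOpen_ball hd h0 hmax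
    have : φ =ᶠ[𝓝 0] fun _ => φ 0 := hc.eventuallyEq_of_mem (ball_mem_nhds _ one_pos)
    rw [this.deriv_eq]
    simp [ha]

/-- If `t ↦ ‖K (t c)‖` is maximal on `[0, 1]` at `t = 1`, then the derivative of its square at
`t = 1` is nonnegative. -/
theorem re_deriv_mul_nonneg {K : ℂ → ℂ} {c k : ℂ} (hK : HasDerivAt K k c)
    (hle : ∀ t ∈ Icc (0 : ℝ) 1, ‖K (t * c)‖ ≤ ‖K c‖) : 0 ≤ (k * c * conj (K c)).re := by
  have hcurve : HasDerivAt (fun t : ℝ => K (t * c)) (k * c) 1 := by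
    have h1 : HasDerivAt (fun t : ℂ => t * c) c ((1 : ℝ) : ℂ) := by
      simpa using (hasDerivAt_id' ((1 : ℝ) : ℂ)).mul_const c
    have h2 : HasDerivAt K k (((1 : ℝ) : ℂ) * c) := by simpa using hK
    have h3 : HasDerivAt (fun t : ℂ => K (t * c)) (k * c) ((1 : ℝ) : ℂ) :=
      HasDerivAt.comp ((1 : ℝ) : ℂ) h2 h1
    exact h3.comp_ofReal
  have hsq : HasDerivAt (fun t : ℝ => ‖K (t * c)‖ ^ 2) (2 * (k * c * conj (K c)).re) 1 := by
    have h := hcurve.norm_sq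
    rwa [Complex.ofReal_one, one_mul, Complex.inner] at h
  have hs := (hasDerivWithinAt_iff_tendsto_slope' (self_notMem_Iio (a := (1 : ℝ)))).mp
    (hsq.hasDerivWithinAt (s := Iio 1))
  have : 0 ≤ 2 * (k * c * conj (K c)).re := by
    refine ge_of_tendsto hs ?_
    filter_upwards [Ioo_mem_nhdsLT (zero_lt_one' ℝ)] with t ht
    rw [slope_def_field]
    refine div_nonneg_of_nonpos ?_ (by linarith [ht.2])
    have h1 := pow_le_pow_left₀ (norm_nonneg _) (hle t ⟨ht.1.le, ht.2.le⟩) 2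
    rw [Complex.ofReal_one, one_mul]
    linarith
  linarith

/-- Let `f(ζ) = ζ h(ζ)` be univalent on the unit disk with inverse `K` and starlike image. Then
`p = ζ f' / f = 1 + ζ h' / h` has nonnegative real part, which is stated here in the equivalent
division-free form `|p - 1| ≤ |p + 1|`, `p + 1 ≠ 0`, multiplied by `h`. -/
theorem norm_mul_deriv_le_of_starlike {h K : ℂ → ℂ} (hh : AnalyticOnNhd ℂ h (ball 0 1))
    (h0 : h 0 = 1)
    (hstar : ∀ ζ ∈ ball (0 : ℂ) 1, ∀ t ∈ Icc (0 : ℝ) 1,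
      ∃ η ∈ ball (0 : ℂ) 1, η * h η = t * (ζ * h ζ))
    (hK : ∀ ζ ∈ ball (0 : ℂ) 1, DifferentiableAt ℂ K (ζ * h ζ))
    (hinv : ∀ ζ ∈ ball (0 : ℂ) 1, K (ζ * h ζ) = ζ) {ζ : ℂ} (hζ : ζ ∈ ball (0 : ℂ) 1) :
    2 * h ζ + ζ * deriv h ζ ≠ 0 ∧ ‖ζ * deriv h ζ‖ ≤ ‖2 * h ζ + ζ * deriv h ζ‖ := by
  rcases eq_or_ne ζ 0 with rfl | hζ0
  · simp [h0]
  have hf : ∀ ξ ∈ ball (0 : ℂ) 1,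
      HasDerivAt (fun ξ => ξ * h ξ) (h ξ + ξ * deriv h ξ) ξ := fun ξ hξ => by
    simpa using (hasDerivAt_id' ξ).fun_mul (hh ξ hξ).differentiableAt.hasDerivAt
  have hKd := (hK ζ hζ).hasDerivAt
  have hone : deriv K (ζ * h ζ) * (h ζ + ζ * deriv h ζ) = 1 := by
    have h1 := HasDerivAt.comp ζ hKd (hf ζ hζ)
    have h2 : K ∘ (fun ξ => ξ * h ξ) =ᶠ[𝓝 ζ] id := by
      filter_upwards [isOpen_ball.mem_nhds hζ] with ξ hξ using hinv ξ hξ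
    exact (h1.congr_of_eventuallyEq h2.symm).unique (hasDerivAt_id ζ)
  have hne : h ζ + ζ * deriv h ζ ≠ 0 := right_ne_zero_of_mul_eq_one hone
  -- The self-map `ξ ↦ K (t f(ξ))` of the disk fixes `0`, so the Schwarz lemma applies to it.
  have hle : ∀ t ∈ Icc (0 : ℝ) 1, ‖K (t * (ζ * h ζ))‖ ≤ ‖ζ‖ := by
    intro t ht
    refine Complex.norm_le_norm_of_mapsTo_ball (f := fun ξ => K (t * (ξ * h ξ))) (R := 1)
      ?_ ?_ ?_ (by simpa using hζ)
    · intro ξ hξ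
      obtain ⟨η, hη, e⟩ := hstar ξ hξ t ht
      have h1 : DifferentiableAt ℂ K (t * (ξ * h ξ)) := e ▸ hK η hη
      exact (h1.comp ξ ((hf ξ hξ).differentiableAt.const_mul _)).differentiableWithinAt
    · intro ξ hξ
      obtain ⟨η, hη, e⟩ := hstar ξ hξ t ht
      simpa [← e, hinv η hη] using (mem_ball_zero_iff.mp hη).le
    · simpa using hinv 0 (mem_ball_self one_pos)
  have hnn := re_deriv_mul_nonneg hKd fun t ht => by simpa [hinv ζ hζ] using hle t ht
  rw [hinv ζ hζ, eq_inv_of_mul_eq_one_left hone] at hnn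
  -- `hnn` says `Re (f conj(ζ) / f') ≥ 0`; pass to `Re (h conj(f')) ≥ 0`.
  have hre : 0 ≤ (h ζ * conj (h ζ + ζ * deriv h ζ)).re := by
    have e : (h ζ + ζ * deriv h ζ)⁻¹ * (ζ * h ζ) * conj ζ
        = ((‖ζ‖ ^ 2 / ‖h ζ + ζ * deriv h ζ‖ ^ 2 : ℝ) : ℂ)
          * (h ζ * conj (h ζ + ζ * deriv h ζ)) := by
      push_cast
      rw [← Complex.mul_conj' ζ, ← Complex.mul_conj' (h ζ + ζ * deriv h ζ)]
      have : conj (h ζ + ζ * deriv h ζ) ≠ 0 := (map_ne_zero _).mpr hne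
      field_simp
    rw [e, Complex.re_ofReal_mul] at hnn
    have hp : 0 < ‖ζ‖ ^ 2 / ‖h ζ + ζ * deriv h ζ‖ ^ 2 := by positivity
    exact nonneg_of_mul_nonneg_right hnn hp
  set a := ζ * deriv h ζ
  -- `|p + 1|² - |p - 1|² = 4 Re p`, multiplied by `|h|²`
  have e : ‖2 * h ζ + a‖ ^ 2 - ‖a‖ ^ 2 = 4 * (h ζ * conj (h ζ + a)).re := by
    simp only [← Complex.normSq_eq_norm_sq, Complex.normSq_apply, Complex.add_re, Complex.add_im,
      Complex.mul_re, Complex.mul_im, Complex.conj_re, Complex.conj_im, map_add,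
      Complex.re_ofNat, Complex.im_ofNat]
    ring
  have hle2 : ‖a‖ ≤ ‖2 * h ζ + a‖ := le_of_sq_le_sq (by linarith) (norm_nonneg _)
  refine ⟨fun hz => hne ?_, hle2⟩
  rw [hz, norm_zero] at hle2
  have ha : a = 0 := norm_le_zero_iff.mp hle2
  have : h ζ = 0 := by simpa [ha] using hz
  simp [ha, this]

/-- Sharp bounds for the second and third coefficients `b₂ = h'(0)`, `b₃ = h''(0) / 2` of a starlike
function `ζ h(ζ)`. The function `ψ = h' / (2 h + ζ h')` is bounded by one, with `ψ(0) = b₂ / 2` and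
`ψ'(0) = (4 b₃ - 3 b₂²) / 4`, so the two bounds are `|ψ(0)| ≤ 1` and `|ψ'(0)| ≤ 1 - |ψ(0)|²`. -/
theorem norm_coeff_le_of_norm_mul_deriv_le {h : ℂ → ℂ} (hh : AnalyticOnNhd ℂ h (ball 0 1))
    (h0 : h 0 = 1)
    (hne : ∀ ζ ∈ ball (0 : ℂ) 1, 2 * h ζ + ζ * deriv h ζ ≠ 0)
    (hle : ∀ ζ ∈ ball (0 : ℂ) 1, ‖ζ * deriv h ζ‖ ≤ ‖2 * h ζ + ζ * deriv h ζ‖) :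
    ‖deriv h 0‖ ≤ 2 ∧
      ‖4 * (deriv (deriv h) 0 / 2) - 3 * deriv h 0 ^ 2‖ ≤ 4 - ‖deriv h 0‖ ^ 2 := by
  have hmem : (0 : ℂ) ∈ ball (0 : ℂ) 1 := mem_ball_self one_pos
  have hh' := hh.deriv
  set ψ : ℂ → ℂ := fun ζ => deriv h ζ / (2 * h ζ + ζ * deriv h ζ) with hψ
  have hψd : DifferentiableOn ℂ ψ (ball 0 1) :=
    hh'.differentiableOn.div ((hh.differentiableOn.const_mul 2).add
      (differentiableOn_id.mul hh'.differentiableOn)) hne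
  -- `|ζ ψ(ζ)| ≤ 1` on the disk, so the Schwarz lemma removes the factor `ζ`.
  have hψle : ∀ ζ ∈ ball (0 : ℂ) 1, ‖ψ ζ‖ ≤ 1 := by
    intro ζ hζ
    have hd : DifferentiableOn ℂ (fun ζ => ζ * ψ ζ) (ball 0 1) := differentiableOn_id.mul hψd
    have hm : MapsTo (fun ζ => ζ * ψ ζ) (ball 0 1) (closedBall (0 * ψ 0) 1) := by
      intro ξ hξ
      have : ξ * ψ ξ = ξ * deriv h ξ / (2 * h ξ + ξ * deriv h ξ) := by
        simp only [hψ]; ring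
      simp only [zero_mul, mem_closedBall_zero_iff, this, norm_div]
      exact div_le_one_of_le₀ (hle ξ hξ) (norm_nonneg _)
    have := Complex.norm_dslope_le_div_of_mapsTo_ball (R₂ := 1) hd hm hζ
    rw [div_one] at this
    rcases eq_or_ne ζ 0 with rfl | hζ0
    · have hp : HasDerivAt (fun ζ => ζ * ψ ζ) (ψ 0) 0 := by
        simpa using (hasDerivAt_id' (0 : ℂ)).fun_mul
          (hψd.differentiableAt (ball_mem_nhds _ one_pos)).hasDerivAt
      rwa [dslope_same, hp.deriv] at this
    · rw [dslope_of_ne _ hζ0, slope_def_field] at this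
      simpa [hζ0] using this
  have hψ0 : ψ 0 = deriv h 0 / 2 := by simp [hψ, h0]
  have hd1 : HasDerivAt h (deriv h 0) 0 := (hh 0 hmem).differentiableAt.hasDerivAt
  have hd2 : HasDerivAt (deriv h) (deriv (deriv h) 0) 0 :=
    (hh' 0 hmem).differentiableAt.hasDerivAt
  have hψ' : deriv ψ 0 = (4 * (deriv (deriv h) 0 / 2) - 3 * deriv h 0 ^ 2) / 4 := by
    have := (hd2.div ((hd1.const_mul 2).add ((hasDerivAt_id (0 : ℂ)).mul hd2)) (hne 0 hmem)).deriv
    refine this.trans ?_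
    simp [h0]
    ring
  have h1 := hψle 0 hmem
  have h2 := norm_deriv_zero_le_one_sub_sq hψd hψle
  rw [hψ0, norm_div, RCLike.norm_ofNat] at h1
  rw [hψ0, hψ', norm_div, norm_div, RCLike.norm_ofNat, RCLike.norm_ofNat] at h2
  constructor <;> linarith

/-- The bound for the symmetric Toeplitz determinant with entries `1, b₂, b₃`: the hypotheses give
`|b₂| ≤ 2`, `|b₃| ≤ 3` and the Fekete–Szegő type estimate `|b₃ - 2 b₂²| ≤ 5`. -/
theorem norm_toeplitz_le {b₂ b₃ : ℂ} (h₂ : ‖b₂‖ ≤ 2)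
    (h₃ : ‖4 * b₃ - 3 * b₂ ^ 2‖ ≤ 4 - ‖b₂‖ ^ 2) :
    ‖2 * b₂ ^ 2 * b₃ - b₃ ^ 2 - 2 * b₂ ^ 2 + 1‖ ≤ 24 := by
  have hs : ‖b₂ ^ 2‖ ≤ 4 := by rw [norm_pow]; nlinarith [norm_nonneg b₂]
  rw [← norm_pow] at h₃
  have hb₃ : ‖b₃‖ ≤ 3 := by
    have h := norm_add_le (4 * b₃ - 3 * b₂ ^ 2) (3 * b₂ ^ 2)
    rw [sub_add_cancel, norm_mul, norm_mul, RCLike.norm_ofNat, RCLike.norm_ofNat] at h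
    linarith
  have hfs : ‖2 * b₂ ^ 2 - b₃‖ ≤ 5 := by
    have h := norm_sub_le (5 * b₂ ^ 2) (4 * b₃ - 3 * b₂ ^ 2)
    rw [show 5 * b₂ ^ 2 - (4 * b₃ - 3 * b₂ ^ 2) = 4 * (2 * b₂ ^ 2 - b₃) by ring, norm_mul,
      norm_mul, RCLike.norm_ofNat, RCLike.norm_ofNat] at h
    linarith
  calc ‖2 * b₂ ^ 2 * b₃ - b₃ ^ 2 - 2 * b₂ ^ 2 + 1‖
      = ‖b₃ * (2 * b₂ ^ 2 - b₃) - 2 * b₂ ^ 2 + 1‖ := by ring_nf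
    _ ≤ ‖b₃‖ * ‖2 * b₂ ^ 2 - b₃‖ + 2 * ‖b₂ ^ 2‖ + 1 := by
      refine (norm_add_le _ _).trans ?_
      have h := norm_sub_le (b₃ * (2 * b₂ ^ 2 - b₃)) (2 * b₂ ^ 2)
      rw [norm_mul, norm_mul 2, RCLike.norm_ofNat] at h
      rw [norm_one]
      linarith
    _ ≤ 24 := by nlinarith [norm_nonneg b₃, norm_nonneg (2 * b₂ ^ 2 - b₃)]

/-! ### Taylor coefficients along a complex line -/

/-- The `n`-th Fréchet derivative on the diagonal is the `n`-th derivative along a complex line. -/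
theorem iteratedFDeriv_const_apply_eq_iteratedDeriv {E F : Type*} [NormedAddCommGroup E]
    [NormedSpace ℂ E] [NormedAddCommGroup F] [NormedSpace ℂ F] {G : E → F} {s : Set E}
    (hs : IsOpen s) (h0 : (0 : E) ∈ s) (n : ℕ) (hG : ContDiffOn ℂ n G s) (u : E) :
    iteratedFDeriv ℂ n G 0 (fun _ => u) = iteratedDeriv n (fun ζ : ℂ => G (ζ • u)) 0 := by
  set L : ℂ →L[ℂ] E := ContinuousLinearMap.toSpanSingleton ℂ u with hL
  have hL0 : L 0 ∈ s := by simpa using h0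
  have ho : IsOpen (L ⁻¹' s) := hs.preimage L.continuous
  have h := L.iteratedFDerivWithin_comp_right hG hs.uniqueDiffOn ho.uniqueDiffOn hL0 le_rfl
  rw [iteratedFDerivWithin_of_isOpen n ho hL0, iteratedFDerivWithin_of_isOpen n hs hL0] at h
  have h' := congrArg (fun m => m fun _ => (1 : ℂ)) h
  rw [map_zero] at h'
  rw [iteratedDeriv_eq_iteratedFDeriv]
  simpa [hL, Function.comp_def] using h'.symm

/-- For `G w = g w • w`, the coefficient `b_k` at `z` is the `k`-th Taylor coefficient of the slice
function `ζ ↦ ζ g(ζ z / ‖z‖)`: the powers of `‖z‖` cancel. -/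
theorem normalizedCoeff_smul_id {X : Type*} [NormedAddCommGroup X] [NormedSpace ℂ X]
    [CompleteSpace X] {g : X → ℂ} (hg : AnalyticOnNhd ℂ g (ball 0 1)) {z : X}
    (hz : z ≠ 0) {l : X →L[ℂ] ℂ} (hl : l ∈ normingFunctionals z) (k : ℕ) :
    normalizedCoeff (fun w => g w • w) z l k =
      iteratedDeriv k (fun ζ : ℂ => ζ * g (ζ • ((‖z‖ : ℂ)⁻¹ • z))) 0 / k.factorial := by
  have hz' : (‖z‖ : ℂ) ≠ 0 := by simpa using hz
  set u : X := (‖z‖ : ℂ)⁻¹ • z with hu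
  have hzu : z = (‖z‖ : ℂ) • u := by rw [hu, smul_inv_smul₀ hz']
  have hlu : l u = 1 := by rw [hu, map_smul, hl.1, smul_eq_mul, inv_mul_cancel₀ hz']
  have hG : AnalyticOnNhd ℂ (fun w => g w • w) (ball 0 1) := hg.smul analyticOnNhd_id
  have h0 : (0 : X) ∈ ball (0 : X) 1 := mem_ball_self one_pos
  have hlG : (fun ζ : ℂ => ζ * g (ζ • u)) = fun ζ => (l ∘ fun w => g w • w) (ζ • u) := by
    ext ζ
    simp [hlu, mul_comm]
  rw [hlG, ← iteratedFDeriv_const_apply_eq_iteratedDeriv isOpen_ball h0 k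
    (((l.analyticOnNhd univ).comp hG (mapsTo_univ _ _)).contDiffOn isOpen_ball.uniqueDiffOn) u,
    l.iteratedFDeriv_comp_left (hG 0 h0).contDiffAt le_rfl]
  have hmul : iteratedFDeriv ℂ k (fun w => g w • w) 0 (fun _ => z)
      = (‖z‖ : ℂ) ^ k • iteratedFDeriv ℂ k (fun w => g w • w) 0 (fun _ => u) := by
    conv_lhs => rw [hzu]
    rw [ContinuousMultilinearMap.map_smul_univ]
    simp
  rw [normalizedCoeff, hmul, map_smul, smul_eq_mul, mul_comm (k.factorial : ℂ),
    mul_div_mul_left _ _ (pow_ne_zero _ hz')]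
  rfl

theorem iteratedDeriv_id_mul {h : ℂ → ℂ} (hh : AnalyticAt ℂ h 0) (k : ℕ) :
    iteratedDeriv (k + 1) (fun ζ => ζ * h ζ) 0 = (k + 1) * iteratedDeriv k h 0 := by
  have := iteratedDeriv_fun_mul (n := k + 1) (f := fun ζ : ℂ => ζ) (g := h) (x := 0)
    contDiffAt_id hh.contDiffAt
  rw [this, Finset.sum_eq_single 1]
  · simp
  · intro i _ hi
    simp [iteratedDeriv_fun_id, hi]
  · simp

theorem normalizedCoeff_two_three {X : Type*} [NormedAddCommGroup X] [NormedSpace ℂ X]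
    [CompleteSpace X] {g : X → ℂ} (hg : AnalyticOnNhd ℂ g (ball 0 1)) {z : X}
    (hz : z ≠ 0) {l : X →L[ℂ] ℂ} (hl : l ∈ normingFunctionals z) {h : ℂ → ℂ}
    (hh : h = fun ζ : ℂ => g (ζ • ((‖z‖ : ℂ)⁻¹ • z))) (hha : AnalyticAt ℂ h 0) :
    normalizedCoeff (fun w => g w • w) z l 2 = deriv h 0 ∧
      normalizedCoeff (fun w => g w • w) z l 3 = deriv (deriv h) 0 / 2 := by
  have e : (fun ζ : ℂ => ζ * g (ζ • ((‖z‖ : ℂ)⁻¹ • z))) = fun ζ => ζ * h ζ := by rw [hh]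
  rw [normalizedCoeff_smul_id hg hz hl, normalizedCoeff_smul_id hg hz hl, e,
    iteratedDeriv_id_mul hha, iteratedDeriv_id_mul hha,
    iteratedDeriv_succ (n := 1), iteratedDeriv_one]
  constructor
  · norm_num [Nat.factorial]
  · norm_num [Nat.factorial]
    ring

/-! ### Reduction to a complex line -/

/-- The image of the slice `ζ ↦ ζ g(ζ u)` inherits starlikeness: a point of `G(𝔹) ∩ ℂ u` comes from a
point of `𝔹 ∩ ℂ u`, because `g` has no zero in the ball when `G` is injective. -/
theorem exists_slice_preimage {X : Type*} [NormedAddCommGroup X] [NormedSpace ℂ X] {g : X → ℂ}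
    (hg0 : g 0 = 1) (hG : ClassSStar fun w : X => g w • w) {u : X} (hu : ‖u‖ = 1) {ζ : ℂ}
    (hζ : ζ ∈ ball (0 : ℂ) 1) {t : ℝ} (ht : t ∈ Icc (0 : ℝ) 1) :
    ∃ η ∈ ball (0 : ℂ) 1, η * g (η • u) = t * (ζ * g (ζ • u)) := by
  obtain ⟨H, -, hH⟩ := hG.biholomorphic.2.2.2
  have hζu : ζ • u ∈ ball (0 : X) 1 := by simpa [norm_smul, hu] using hζ
  obtain ⟨w, hw, hwe⟩ :=
    (starConvex_zero_iff.mp hG.starlike) (mem_image_of_mem _ hζu) ht.1 ht.2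
  have hgw : g w ≠ 0 := by
    intro h
    have h1 := hH w hw
    have h2 := hH 0 (mem_ball_self one_pos)
    simp only [h, zero_smul] at h1
    simp only [smul_zero] at h2
    rw [← h1, h2, hg0] at h
    exact one_ne_zero h
  have hwu : w = ((g w)⁻¹ * (t * (ζ * g (ζ • u)))) • u := by
    have h1 : g w • w = (t * (ζ * g (ζ • u))) • u := by
      refine hwe.trans ?_
      rw [← Complex.coe_smul, smul_smul, smul_smul]
      ring_nf
    rw [mul_smul, ← h1, inv_smul_smul₀ hgw]
  refine ⟨(g w)⁻¹ * (t * (ζ * g (ζ • u))), ?_, ?_⟩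
  · rw [hwu] at hw
    simpa only [mem_ball_zero_iff, norm_smul, hu, mul_one] using hw
  · rw [← hwu]
    field_simp

theorem norm_toeplitz_normalizedCoeff_le {X : Type*} [NormedAddCommGroup X] [NormedSpace ℂ X]
    [CompleteSpace X] {g : X → ℂ} (hg : AnalyticOnNhd ℂ g (ball 0 1)) (hg0 : g 0 = 1)
    (hG : ClassSStar fun w : X => g w • w) {z : X} (hz : z ≠ 0) {l : X →L[ℂ] ℂ}
    (hl : l ∈ normingFunctionals z) {b₂ b₃ : ℂ}
    (h₂ : b₂ = normalizedCoeff (fun w : X => g w • w) z l 2)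
    (h₃ : b₃ = normalizedCoeff (fun w : X => g w • w) z l 3) :
    ‖2 * b₂ ^ 2 * b₃ - b₃ ^ 2 - 2 * b₂ ^ 2 + 1‖ ≤ 24 := by
  have hz' : (‖z‖ : ℂ) ≠ 0 := by simpa using hz
  set u : X := (‖z‖ : ℂ)⁻¹ • z with hu
  have hlu : l u = 1 := by rw [hu, map_smul, hl.1, smul_eq_mul, inv_mul_cancel₀ hz']
  have hu1 : ‖u‖ = 1 := by
    rw [hu, norm_smul, norm_inv, Complex.norm_real, norm_norm,
      inv_mul_cancel₀ (norm_ne_zero_iff.mpr hz)]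
  have hmaps : ∀ ζ ∈ ball (0 : ℂ) 1, ζ • u ∈ ball (0 : X) 1 := fun ζ hζ => by
    simpa [norm_smul, hu1] using hζ
  set h : ℂ → ℂ := fun ζ => g (ζ • u) with hh
  have hha : AnalyticOnNhd ℂ h (ball 0 1) := fun ζ hζ =>
    (hg _ (hmaps ζ hζ)).comp (f := fun ζ : ℂ => ζ • u) (analyticAt_id.smul analyticAt_const)
  have h0 : h 0 = 1 := by simp [hh, hg0]
  obtain ⟨H, hHa, hH⟩ := hG.biholomorphic.2.2.2
  have hGu : ∀ ζ : ℂ, g (ζ • u) • ζ • u = (ζ * h ζ) • u := fun ζ => by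
    rw [smul_smul, mul_comm]
  have hslice : ∀ ζ ∈ ball (0 : ℂ) 1, _ := fun ζ hζ =>
    norm_mul_deriv_le_of_starlike (K := fun c => l (H (c • u))) hha h0
      (fun ξ hξ t ht => exists_slice_preimage hg0 hG hu1 hξ ht)
      (fun ξ hξ => by
        have h1 : DifferentiableAt ℂ H ((ξ * h ξ) • u) := by
          rw [← hGu]
          exact (hHa _ (mem_image_of_mem _ (hmaps ξ hξ))).differentiableAt
        exact l.differentiableAt.comp _ (h1.comp (ξ * h ξ) (f := fun c : ℂ => c • u)
          (differentiableAt_id.smul_const u)))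
      (fun ξ hξ => by
        have h1 := hH _ (hmaps ξ hξ)
        simp only [hGu] at h1
        simp [h1, hlu]) hζ
  obtain ⟨e₂, e₃⟩ := normalizedCoeff_two_three hg hz hl hh (hha 0 (mem_ball_self one_pos))
  obtain ⟨k₂, k₃⟩ := norm_coeff_le_of_norm_mul_deriv_le hha h0 (fun ζ hζ => (hslice ζ hζ).1)
    fun ζ hζ => (hslice ζ hζ).2
  rw [← e₂, ← h₂] at k₂
  rw [← e₂, ← e₃, ← h₂, ← h₃] at k₃
  exact norm_toeplitz_le k₂ k₃

/-! ### The Koebe mapping in the direction of a functional -/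

theorem cpow_two_inv_sq (x : ℂ) : (x ^ (2⁻¹ : ℂ)) ^ 2 = x := by
  exact_mod_cast Complex.cpow_nat_inv_pow x two_ne_zero

theorem re_cpow_two_inv_pos {x : ℂ} (hx : x ∈ Complex.slitPlane) :
    0 < (x ^ (2⁻¹ : ℂ)).re := by
  have hx0 := Complex.slitPlane_ne_zero hx
  have h1 := Complex.mem_slitPlane_iff_arg.mp hx
  rw [Complex.cpow_def_of_ne_zero hx0, Complex.exp_re]
  refine mul_pos (Real.exp_pos _) (Real.cos_pos_of_mem_Ioo ?_)
  have e : (Complex.log x * 2⁻¹).im = x.arg / 2 := by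
    have : Complex.log x * 2⁻¹ = ((2⁻¹ : ℝ) : ℂ) * Complex.log x := by push_cast; ring
    rw [this, Complex.im_ofReal_mul, Complex.log_im]
    ring
  rw [e]
  have h2 := Complex.neg_pi_lt_arg x
  have h3 := (Complex.arg_le_pi x).lt_of_ne h1.1
  constructor <;> linarith

theorem sq_mem_slitPlane {q : ℂ} (hq : 0 < q.re) : q ^ 2 ∈ Complex.slitPlane := by
  rw [Complex.mem_slitPlane_iff]
  by_cases him : q.im = 0
  · left; simp only [sq, Complex.mul_re, him]; nlinarith
  · right
    simp only [sq, Complex.mul_im]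
    have := mul_ne_zero hq.ne' him
    intro h
    apply this
    linarith

/-- If `p² = (1 - t) + t s²` with `0 ≤ t ≤ 1` and `Re p ≥ 0`, then
`√t |s + 1| ≤ |p + 1|`. With `s`, `p` the square roots of `1 + 4 i l(y)` and `1 + 4 i l(t y)`, this is
what makes the image of the Koebe mapping starlike. -/
theorem mul_norm_add_one_sq_le {s p : ℂ} {t : ℝ} (ht : t ∈ Icc (0 : ℝ) 1) (hp : 0 ≤ p.re)
    (h : p ^ 2 = (1 - t : ℝ) + (t : ℂ) * s ^ 2) :
    t * ‖s + 1‖ ^ 2 ≤ ‖p + 1‖ ^ 2 := by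
  obtain ⟨ht0, ht1⟩ := ht
  have hn : t * ‖s‖ ^ 2 ≤ ‖p‖ ^ 2 + (1 - t) := by
    have h1 := norm_sub_le (p ^ 2) ((1 - t : ℝ) : ℂ)
    rw [h, add_sub_cancel_left, ← h, norm_mul, norm_pow, norm_pow, Complex.norm_real,
      Complex.norm_real, Real.norm_of_nonneg ht0, Real.norm_of_nonneg (by linarith)] at h1
    exact h1
  have hre : p.re ^ 2 - p.im ^ 2 = (1 - t) + t * (s.re ^ 2 - s.im ^ 2) := by
    have := congrArg Complex.re h
    rw [Complex.add_re, Complex.re_ofReal_mul, Complex.ofReal_re, sq, sq, Complex.mul_re,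
      Complex.mul_re] at this
    linarith
  have ns : ‖s‖ ^ 2 = s.re ^ 2 + s.im ^ 2 := by
    rw [← Complex.normSq_eq_norm_sq, Complex.normSq_apply]; ring
  have np : ‖p‖ ^ 2 = p.re ^ 2 + p.im ^ 2 := by
    rw [← Complex.normSq_eq_norm_sq, Complex.normSq_apply]; ring
  have ns1 : ‖s + 1‖ ^ 2 = ‖s‖ ^ 2 + 2 * s.re + 1 := by
    rw [ns, ← Complex.normSq_eq_norm_sq, Complex.normSq_apply]; simp; ring
  have np1 : ‖p + 1‖ ^ 2 = ‖p‖ ^ 2 + 2 * p.re + 1 := by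
    rw [np, ← Complex.normSq_eq_norm_sq, Complex.normSq_apply]; simp; ring
  -- `2 (Re p)² = |p²| + Re p² ≥ t |s²| + t Re s² = 2 t (Re s)²`
  have hr : t * s.re ≤ p.re := by
    refine le_of_sq_le_sq ?_ hp
    have : t * s.re ^ 2 ≤ p.re ^ 2 := by rw [ns, np] at hn; linarith
    nlinarith [mul_nonneg (mul_nonneg ht0 (sub_nonneg.mpr ht1)) (sq_nonneg s.re)]
  rw [ns1, np1]
  nlinarith

/-- The principal square root of `1 + 4 i l(y)`. For `y` the image of `w` under the Koebe mapping it
is the Cayley transform `(1 + i l(w)) / (1 - i l(w))`. -/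
noncomputable def koebeRoot {X : Type*} [NormedAddCommGroup X] [NormedSpace ℂ X]
    (l : X →L[ℂ] ℂ) (y : X) : ℂ := (1 + 4 * Complex.I * l y) ^ (2⁻¹ : ℂ)

/-- The inverse of the Koebe mapping `w ↦ w / (1 - i l(w))²` on the image of the unit ball. -/
noncomputable def koebeInv {X : Type*} [NormedAddCommGroup X] [NormedSpace ℂ X]
    (l : X →L[ℂ] ℂ) (y : X) : X := (4 / (koebeRoot l y + 1) ^ 2) • y

/-- The scalar factor `(1 - i l(w))⁻²` of the rotated Koebe mapping in the direction of `l`. -/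
noncomputable def koebeFactor {X : Type*} [NormedAddCommGroup X] [NormedSpace ℂ X]
    (l : X →L[ℂ] ℂ) (w : X) : ℂ := ((1 - Complex.I * l w) ^ 2)⁻¹

theorem one_sub_I_mul_ne_zero {x : ℂ} (hx : ‖x‖ < 1) : 1 - Complex.I * x ≠ 0 := by
  intro h
  have : ‖Complex.I * x‖ = 1 := by rw [← sub_eq_zero.mp h, norm_one]
  rw [norm_mul, Complex.norm_I, one_mul] at this
  exact hx.ne this

theorem analyticOnNhd_koebeFactor {X : Type*} [NormedAddCommGroup X] [NormedSpace ℂ X]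
    {l : X →L[ℂ] ℂ} (hl : ‖l‖ ≤ 1) :
    AnalyticOnNhd ℂ (koebeFactor l) (ball 0 1) := by
  intro w hw
  have hlw : ‖l w‖ < 1 := (l.le_of_opNorm_le hl w).trans_lt (by simpa using hw)
  exact ((analyticAt_const.sub (analyticAt_const.mul (l.analyticAt w))).pow 2).inv
    (pow_ne_zero _ (one_sub_I_mul_ne_zero hlw))

theorem re_cayley_pos {x : ℂ} (hx : ‖x‖ < 1) :
    0 < ((1 + Complex.I * x) / (1 - Complex.I * x)).re := by
  have hne := one_sub_I_mul_ne_zero hx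
  have hx2 : x.re ^ 2 + x.im ^ 2 < 1 := by
    have : ‖x‖ ^ 2 < 1 := by nlinarith [norm_nonneg x]
    rw [← Complex.normSq_eq_norm_sq, Complex.normSq_apply] at this
    linarith
  rw [Complex.div_re, ← add_div]
  refine div_pos ?_ (Complex.normSq_pos.mpr hne)
  simp
  nlinarith

/-- `koebeInv l` is a right inverse of the Koebe mapping off the slit: with `s = koebeRoot l y`, both
`s² = 1 + 4 i l(y)` and `1 - i l(koebeInv l y) = 2 / (s + 1)` hold. -/
theorem koebeFactor_smul_koebeInv {X : Type*} [NormedAddCommGroup X] [NormedSpace ℂ X]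
    {l : X →L[ℂ] ℂ} {y : X}
    (hy : 1 + 4 * Complex.I * l y ∈ Complex.slitPlane) :
    koebeFactor l (koebeInv l y) • koebeInv l y = y := by
  have hs := re_cpow_two_inv_pos hy
  have hsq := cpow_two_inv_sq (1 + 4 * Complex.I * l y)
  change 0 < (koebeRoot l y).re at hs
  change koebeRoot l y ^ 2 = _ at hsq
  have hne : koebeRoot l y + 1 ≠ 0 := fun h => by
    have := congrArg Complex.re h
    simp at this
    linarith
  have e : 1 - Complex.I * l (koebeInv l y) = 2 / (koebeRoot l y + 1) := by
    rw [koebeInv, map_smul, smul_eq_mul]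
    field_simp
    linear_combination hsq
  rw [koebeFactor, e]
  conv_lhs => rw [koebeInv]
  rw [smul_smul]
  convert one_smul ℂ y
  field_simp
  norm_num

/-- `koebeInv l` is a left inverse of the Koebe mapping on the ball, because the Cayley transform of
`l w` lies in the right half-plane and is therefore the principal square root of its square. -/
theorem mem_slitPlane_and_koebeInv_koebe {X : Type*} [NormedAddCommGroup X] [NormedSpace ℂ X]
    {l : X →L[ℂ] ℂ} (hl : ‖l‖ ≤ 1) {w : X} (hw : w ∈ ball (0 : X) 1) :
    1 + 4 * Complex.I * l (koebeFactor l w • w) ∈ Complex.slitPlane ∧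
      koebeInv l (koebeFactor l w • w) = w := by
  have hlw : ‖l w‖ < 1 := (l.le_of_opNorm_le hl w).trans_lt (by simpa using hw)
  have hne := one_sub_I_mul_ne_zero hlw
  have hpos := re_cayley_pos hlw
  have e : 1 + 4 * Complex.I * l (koebeFactor l w • w)
      = ((1 + Complex.I * l w) / (1 - Complex.I * l w)) ^ 2 := by
    rw [koebeFactor, map_smul, smul_eq_mul]
    field_simp
    ring
  have hr : koebeRoot l (koebeFactor l w • w)
      = (1 + Complex.I * l w) / (1 - Complex.I * l w) := by
    rw [koebeRoot, e, Complex.sq_cpow_two_inv hpos]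
  refine ⟨e ▸ sq_mem_slitPlane hpos, ?_⟩
  rw [koebeInv, hr, smul_smul]
  convert one_smul ℂ w
  have h1 : (1 + Complex.I * l w) / (1 - Complex.I * l w) + 1 = 2 / (1 - Complex.I * l w) := by
    field_simp; ring
  rw [h1, koebeFactor]
  field_simp
  norm_num

theorem image_koebeFactor_smul {X : Type*} [NormedAddCommGroup X] [NormedSpace ℂ X]
    {l : X →L[ℂ] ℂ} (hl : ‖l‖ ≤ 1) :
    (fun w => koebeFactor l w • w) '' ball 0 1 =
      {y | 1 + 4 * Complex.I * l y ∈ Complex.slitPlane} ∩ koebeInv l ⁻¹' ball 0 1 := by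
  ext y
  constructor
  · rintro ⟨w, hw, rfl⟩
    obtain ⟨h1, h2⟩ := mem_slitPlane_and_koebeInv_koebe hl hw
    exact ⟨h1, by simpa only [mem_preimage, h2] using hw⟩
  · rintro ⟨h1, h2⟩
    exact ⟨_, h2, koebeFactor_smul_koebeInv h1⟩

theorem analyticOnNhd_koebeInv {X : Type*} [NormedAddCommGroup X] [NormedSpace ℂ X]
    (l : X →L[ℂ] ℂ) :
    AnalyticOnNhd ℂ (koebeInv l) {y | 1 + 4 * Complex.I * l y ∈ Complex.slitPlane} := by
  intro y hy
  have hr : AnalyticAt ℂ (koebeRoot l) y :=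
    (analyticAt_const.add (analyticAt_const.mul (l.analyticAt y))).cpow analyticAt_const hy
  have hne : koebeRoot l y + 1 ≠ 0 := fun h => by
    have h1 : 0 < (koebeRoot l y).re := re_cpow_two_inv_pos hy
    have := congrArg Complex.re h
    simp at this
    linarith
  exact (analyticAt_const.div ((hr.add analyticAt_const).pow 2) (pow_ne_zero _ hne)).smul
    analyticAt_id

theorem classSStar_koebe {X : Type*} [NormedAddCommGroup X] [NormedSpace ℂ X]
    {l : X →L[ℂ] ℂ} (hl : ‖l‖ ≤ 1) :
    ClassSStar (fun w => koebeFactor l w • w) := by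
  have hG : AnalyticOnNhd ℂ (fun w => koebeFactor l w • w) (ball 0 1) :=
    (analyticOnNhd_koebeFactor hl).smul analyticOnNhd_id
  have hH := analyticOnNhd_koebeInv l
  refine ⟨⟨⟨hG, ?_, ?_, koebeInv l, ?_, fun w hw => (mem_slitPlane_and_koebeInv_koebe hl hw).2⟩,
    by simp, ?_⟩, ?_⟩
  · rw [image_koebeFactor_smul hl]
    refine hH.continuousOn.isOpen_inter_preimage ?_ isOpen_ball
    exact Complex.isOpen_slitPlane.preimage (by fun_prop)
  · exact ((convex_ball (0 : X) 1).isConnected ⟨0, mem_ball_self one_pos⟩).image _ hG.continuousOn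
  · rw [image_koebeFactor_smul hl]
    exact hH.mono inter_subset_left
  · have hd := (analyticOnNhd_koebeFactor hl 0 (mem_ball_self one_pos)).differentiableAt
    have h1 := (hd.hasFDerivAt.fun_smul (hasFDerivAt_id (0 : X))).fderiv
    refine h1.trans ?_
    ext v
    simp [koebeFactor]
  · rw [image_koebeFactor_smul hl, starConvex_zero_iff]
    rintro y ⟨hy, hb⟩ t ht0 ht1
    have e : 1 + 4 * Complex.I * l (t • y)
        = ((1 - t : ℝ) : ℂ) + t * (1 + 4 * Complex.I * l y) := by
      rw [l.map_smul_of_tower, Complex.real_smul]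
      push_cast
      ring
    have hty : 1 + 4 * Complex.I * l (t • y) ∈ Complex.slitPlane := by
      have := Complex.starConvex_one_slitPlane hy (sub_nonneg.mpr ht1) ht0 (by ring)
      rwa [Complex.real_smul, Complex.real_smul, mul_one, ← e] at this
    refine ⟨hty, ?_⟩
    have hs : 0 < (koebeRoot l y).re := re_cpow_two_inv_pos hy
    have hp : 0 < (koebeRoot l (t • y)).re := re_cpow_two_inv_pos hty
    have hsq : koebeRoot l y ^ 2 = 1 + 4 * Complex.I * l y := cpow_two_inv_sq _
    have hpq : koebeRoot l (t • y) ^ 2 = 1 + 4 * Complex.I * l (t • y) := cpow_two_inv_sq _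
    have key := mul_norm_add_one_sq_le (s := koebeRoot l y) ⟨ht0, ht1⟩ hp.le (by rw [hpq, hsq, e])
    have pos : ∀ {s : ℂ}, 0 < s.re → 0 < ‖s + 1‖ ^ 2 := fun {s} h => by
      have : s + 1 ≠ 0 := fun h0 => by
        have := congrArg Complex.re h0
        simp at this
        linarith
      positivity
    rw [mem_preimage, mem_ball_zero_iff] at hb ⊢
    refine lt_of_le_of_lt ?_ hb
    rw [koebeInv, koebeInv, norm_smul, norm_smul, norm_smul, norm_div, norm_div, norm_pow,
      norm_pow, Real.norm_of_nonneg ht0, ← mul_assoc]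
    refine mul_le_mul_of_nonneg_right ?_ (norm_nonneg _)
    rw [div_mul_eq_mul_div, div_le_div_iff₀ (pos hp) (pos hs), RCLike.norm_ofNat]
    linarith

theorem deriv_koebe :
    deriv (fun ζ : ℂ => ((1 - Complex.I * ζ) ^ 2)⁻¹) 0 = 2 * Complex.I ∧
      deriv (deriv fun ζ : ℂ => ((1 - Complex.I * ζ) ^ 2)⁻¹) 0 = -6 := by
  have hb : ∀ ζ : ℂ, HasDerivAt (fun ζ : ℂ => 1 - Complex.I * ζ) (-Complex.I) ζ := fun ζ => by
    simpa using ((hasDerivAt_id' ζ).const_mul Complex.I).const_sub 1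
  have h1 : ∀ ζ ∈ ball (0 : ℂ) 1, HasDerivAt (fun ζ : ℂ => ((1 - Complex.I * ζ) ^ 2)⁻¹)
      (2 * Complex.I * ((1 - Complex.I * ζ) ^ 3)⁻¹) ζ := fun ζ hζ => by
    have hne := one_sub_I_mul_ne_zero (mem_ball_zero_iff.mp hζ)
    refine (((hb ζ).fun_pow 2).fun_inv (pow_ne_zero 2 hne)).congr_deriv ?_
    field_simp
    norm_num
    ring
  have h2 : HasDerivAt (fun ζ : ℂ => 2 * Complex.I * ((1 - Complex.I * ζ) ^ 3)⁻¹) (-6) 0 := by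
    refine ((((hb 0).fun_pow 3).fun_inv (by simp)).const_mul (2 * Complex.I)).congr_deriv ?_
    simp
    linear_combination 6 * Complex.I_sq
  refine ⟨by simpa using (h1 0 (mem_ball_self one_pos)).deriv, ?_⟩
  have h3 : deriv (fun ζ : ℂ => ((1 - Complex.I * ζ) ^ 2)⁻¹) =ᶠ[𝓝 0]
      fun ζ => 2 * Complex.I * ((1 - Complex.I * ζ) ^ 3)⁻¹ := by
    filter_upwards [ball_mem_nhds (0 : ℂ) one_pos] with ζ hζ using (h1 ζ hζ).deriv
  rw [h3.deriv_eq, h2.deriv]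

theorem normalizedCoeff_koebe {X : Type*} [NormedAddCommGroup X] [NormedSpace ℂ X]
    [CompleteSpace X] {z : X} (hz : z ≠ 0) {l : X →L[ℂ] ℂ} (hl : l ∈ normingFunctionals z) :
    normalizedCoeff (fun w => koebeFactor l w • w) z l 2 = 2 * Complex.I ∧
      normalizedCoeff (fun w => koebeFactor l w • w) z l 3 = -3 := by
  have hz' : (‖z‖ : ℂ) ≠ 0 := by simpa using hz
  have hh : (fun ζ : ℂ => ((1 - Complex.I * ζ) ^ 2)⁻¹)
      = fun ζ : ℂ => koebeFactor l (ζ • ((‖z‖ : ℂ)⁻¹ • z)) := by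
    ext ζ
    rw [koebeFactor, map_smul, map_smul, hl.1, smul_eq_mul, smul_eq_mul, inv_mul_cancel₀ hz',
      mul_one]
  have ha : AnalyticAt ℂ (fun ζ : ℂ => ((1 - Complex.I * ζ) ^ 2)⁻¹) 0 :=
    ((analyticAt_const.sub (analyticAt_const.mul analyticAt_id)).pow 2).inv (by simp)
  obtain ⟨e₂, e₃⟩ := normalizedCoeff_two_three (analyticOnNhd_koebeFactor hl.2.le) hz hl hh ha
  rw [e₂, e₃, deriv_koebe.1, deriv_koebe.2]
  norm_num

/-! ### The sharp estimate -/

theorem mainTheorem9 (X : Type*) [NormedAddCommGroup X] [NormedSpace ℂ X] [CompleteSpace X] :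
    -- the bound
    (∀ g : X → ℂ, AnalyticOnNhd ℂ g (Metric.ball 0 1) → g 0 = 1 →
      ClassSStar (fun w : X => g w • w) →
      ∀ z ∈ Metric.ball (0 : X) 1, z ≠ 0 → ∀ l ∈ normingFunctionals z, ∀ b₂ b₃ : ℂ,
        b₂ = normalizedCoeff (fun w : X => g w • w) z l 2 →
        b₃ = normalizedCoeff (fun w : X => g w • w) z l 3 →
        ‖2 * b₂ ^ 2 * b₃ - b₃ ^ 2 - 2 * b₂ ^ 2 + 1‖ ≤ 24) ∧
    -- sharpness: equality is attained at every nonzero point of the ball and every functional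
    (∀ z ∈ Metric.ball (0 : X) 1, z ≠ 0 → ∀ l ∈ normingFunctionals z,
      ∃ g : X → ℂ, AnalyticOnNhd ℂ g (Metric.ball 0 1) ∧ g 0 = 1 ∧
        ClassSStar (fun w : X => g w • w) ∧
        ∃ b₂ b₃ : ℂ,
          b₂ = normalizedCoeff (fun w : X => g w • w) z l 2 ∧
          b₃ = normalizedCoeff (fun w : X => g w • w) z l 3 ∧
          ‖2 * b₂ ^ 2 * b₃ - b₃ ^ 2 - 2 * b₂ ^ 2 + 1‖ = 24) := by
  refine ⟨fun g hg hg0 hG z _ hz l hl b₂ b₃ h₂ h₃ =>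
    norm_toeplitz_normalizedCoeff_le hg hg0 hG hz hl h₂ h₃, fun z _ hz l hl => ?_⟩
  obtain ⟨e₂, e₃⟩ := normalizedCoeff_koebe hz hl
  refine ⟨koebeFactor l, analyticOnNhd_koebeFactor hl.2.le, by simp [koebeFactor],
    classSStar_koebe hl.2.le, 2 * Complex.I, -3, e₂.symm, e₃.symm, ?_⟩
  have : 2 * (2 * Complex.I) ^ 2 * (-3) - (-3) ^ 2 - 2 * (2 * Complex.I) ^ 2 + 1 = 24 := by
    linear_combination (-32) * Complex.I_sq
  rw [this, RCLike.norm_ofNat]
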